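/- Let $H\in(0,1)$ and let $S^H=\{S^H_t,\ t\ge 0\}$ be a sub-fractional Brownian motion with parameter $H$ on a probability space $(\Omega,\mathcal F,\mathbb P)$, that is, a centred Gaussian process with covariance $$\mathbb E(S^H_sS^H_t)=s^{2H}+t^{2H}-\tfrac12\left[(s+t)^{2H}+|s-t|^{2H}\right],\qquad s,t\ge 0,$$ which is (up to a null set) jointly measurable in $(t,\omega)\in(0,1)\times\Omega$; for instance, one with almost surely continuous paths. Let $I=(0,1)$ and, for $h\in\mathbb R$, let $I(h)=\{s\in I: s+h\in I\}$. For measurable $A\subseteq I$ and a measurable function $g$ on $A$ put $$\|g\|_{L^{\Phi_2}(A)}=\sup_{p\ge 1}p^{-1/2}\|g\|_{L^p(A)},$$ a norm of the exponential Orlicz space of the Young function $\Phi_2(x)=e^{x^2}-1$. Let $\mathcal B^{H}_{\Phi_2,\infty}(I)$ be the Besov--Orlicz space of all measurable $f$ on $I$ with $\|f\|_{L^{\Phi_2}(I)}<\infty$ and $$\sup_{0<t\le 1}t^{-H}\sup_{|h|\le t}\|f(\cdot+h)-f(\cdot)\|_{L^{\Phi_2}(I(h))}<\infty .$$ Then,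 for $\mathbb P$-almost every $\omega$, the path $t\mapsto S^H_t(\omega)$, $t\in I$, belongs to $\mathcal B^{H}_{\Phi_2,\infty}(I)$. -/

import Mathlib

open MeasureTheory ProbabilityTheory Set
open scoped NNReal ENNReal

noncomputable section

/-- The set `I(h) = {s ∈ I : s + h ∈ I}` for the interval `I = (0, 1)`. -/
def shiftDomain (h : ℝ) : Set ℝ :=
  {s | s ∈ Ioo (0 : ℝ) 1 ∧ s + h ∈ Ioo (0 : ℝ) 1}

/-- The norm of the exponential Orlicz space `L^{Φ_β}(A)`, where `Φ_β(x) = exp(x^β) - 1`: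
the supremum of `p^{-1/β} ‖f‖_{L^p(A)}` over all real `p ≥ 1`, with values in `[0, ∞]`. -/
def expOrliczNorm (β : ℝ) (f : ℝ → ℝ) (A : Set ℝ) : ℝ≥0∞ :=
  ⨆ (p : ℝ) (_ : 1 ≤ p),
    ENNReal.ofReal (p ^ (-(1 / β))) * eLpNorm f (ENNReal.ofReal p) (volume.restrict A)

/-- The modulus of smoothness of `f` on `(0, 1)` in the exponential Orlicz norm: the supremum
over `|h| ≤ t` of the `L^{Φ_β}(I(h))`-norm of `s ↦ f (s + h) - f s`. -/
def orliczModulus (β : ℝ) (f : ℝ → ℝ) (t : ℝ) : ℝ≥0∞ :=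
  ⨆ (h : ℝ) (_ : |h| ≤ t), expOrliczNorm β (fun s => f (s + h) - f s) (shiftDomain h)

/-- The Besov-Orlicz seminorm: the supremum over `0 < t ≤ 1` of `t^{-α}` times the modulus. -/
def besovOrliczSeminorm (α β : ℝ) (f : ℝ → ℝ) : ℝ≥0∞ :=
  ⨆ (t : ℝ) (_ : 0 < t ∧ t ≤ 1), ENNReal.ofReal (t ^ (-α)) * orliczModulus β f t

/-- The Besov-Orlicz space of smoothness `α` on `(0, 1)` for the Young function `Φ_β` and third
index `∞`, as a set of functions `f : ℝ → ℝ`, of which only the values on `(0, 1)` matter. -/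
def BesovOrliczSpace (α β : ℝ) : Set (ℝ → ℝ) :=
  {f | AEMeasurable f (volume.restrict (Ioo (0 : ℝ) 1)) ∧
    expOrliczNorm β f (Ioo (0 : ℝ) 1) < ∞ ∧
    besovOrliczSeminorm α β f < ∞}

/-- `S` is a sub-fractional Brownian motion with parameter `H` under `P`: a centred Gaussian
process on `[0, ∞)` with the sub-fractional covariance function. -/
structure IsSubfractionalBrownianMotion {Ω : Type*} [MeasurableSpace Ω] (H : ℝ)
    (S : ℝ≥0 → Ω → ℝ) (P : Measure Ω) : Prop where
  isGaussianProcess : IsGaussianProcess S P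
  centred : ∀ t : ℝ≥0, ∫ ω, S t ω ∂P = 0
  covariance_eq : ∀ s t : ℝ≥0, cov[S s, S t; P] =
    (s : ℝ) ^ (2 * H) + (t : ℝ) ^ (2 * H)
      - (1 / 2) * (((s : ℝ) + (t : ℝ)) ^ (2 * H) + |(s : ℝ) - (t : ℝ)| ^ (2 * H))

end

/-! Write $d_n=2^{-(n+1)}$ and
$G_n(\omega)=\int_{I(d_n)}\exp\bigl(c\,(S_{s+d_n}-S_s)^2/d_n^{2H}\bigr)ds$. Everything reduces to
$\sup_n G_n<\infty$ almost surely, for a small $c>0$.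

Given such a bound, $|x|^p\le (p/2c)^{p/2}e^{cx^2}$ yields
$\|S_{\cdot+d_n}-S_\cdot\|_{L^p(I(d_n))}\le A\,p^{1/2}d_n^H$ with $A$ independent of $p$ and $n$. A
general shift is a sum of distinct dyadic ones, so the triangle inequality, a geometric series and
continuity of translation in $L^p$ cover all $h$ (`eLpNorm_shift_le_of_dyadic`).

For the bound on $G_n$, the normalised increments have variance at most $18$, so the means of the
$G_n$ are bounded by one Gaussian integral $\kappa$. The fluctuations are controlled by a second
moment: the covariance of $e^{cX^2}$ and $e^{cY^2}$ for centred jointly Gaussian $X,Y$ is at most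
linear in $|\mathrm{cov}(X,Y)|$ (`lintegral_exp_sq_mul_exp_sq_le`), and covariances of increments
decay away from the diagonal, being second differences of $|u|^{2H}$ with $H<1$. Hence
$\sum_n\mathbb E[(G_n-\mathbb E G_n)_+^2]<\infty$, which bounds $G_n$ uniformly in $n$
(`ae_exists_bound_of_tsum_lintegral_tsub_sq`). -/

section BesovOrlicz

open Filter Topology

/-! ### From exponential square integrals to $L^p$ norms. -/

lemma abs_rpow_le_mul_exp_sq {c p : ℝ} (hc : 0 < c) (hp : 0 < p) (x : ℝ) :
    |x| ^ p ≤ (p / (2 * c)) ^ (p / 2) * Real.exp (c * x ^ 2) := by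
  -- The bound is $y\le e^y$ at $y=2cx^2/p$, raised to the power $p/2$.
  have h1 : 2 * c * x ^ 2 / p ≤ Real.exp (2 * c * x ^ 2 / p) := by
    linarith [Real.add_one_le_exp (2 * c * x ^ 2 / p)]
  have h2 : (2 * c * x ^ 2 / p) ^ (p / 2) ≤ Real.exp (c * x ^ 2) := by
    refine (Real.rpow_le_rpow (by positivity) h1 (by positivity)).trans_eq ?_
    rw [← Real.exp_mul]
    congr 1
    field_simp
  have h3 : |x| ^ p = (p / (2 * c)) ^ (p / 2) * (2 * c * x ^ 2 / p) ^ (p / 2) := by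
    rw [← Real.mul_rpow (by positivity) (by positivity)]
    have : p / (2 * c) * (2 * c * x ^ 2 / p) = |x| ^ (2 : ℝ) := by
      rw [Real.rpow_two, sq_abs]; field_simp
    rw [this, ← Real.rpow_mul (abs_nonneg _)]
    congr 1; ring
  rw [h3]
  gcongr

/-- The $p$-th root of $(p/2c)^{p/2}$ is a multiple of $p^{1/2}$, exactly the growth that
$L^{\Phi_2}$ permits; $M\ge 1$ absorbs $M^{1/p}$ into $M$. -/
lemma eLpNorm_le_of_lintegral_exp_sq_le {α : Type*} [MeasurableSpace α] {μ : Measure α}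
    {f : α → ℝ} {c M p : ℝ} (hc : 0 < c) (hM : 1 ≤ M) (hp : 1 ≤ p)
    (h : ∫⁻ x, ENNReal.ofReal (Real.exp (c * f x ^ 2)) ∂μ ≤ ENNReal.ofReal M) :
    eLpNorm f (ENNReal.ofReal p) μ ≤ ENNReal.ofReal ((2 * c) ^ (-(1 / 2) : ℝ) * M * p ^ (1 / 2 : ℝ)) := by
  have hp0 : 0 < p := by linarith
  rw [eLpNorm_eq_lintegral_rpow_enorm_toReal (by simpa using hp0) ENNReal.ofReal_ne_top,
    ENNReal.toReal_ofReal hp0.le]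
  have h1 : ∫⁻ x, ‖f x‖ₑ ^ p ∂μ ≤ ENNReal.ofReal ((p / (2 * c)) ^ (p / 2) * M) := by
    calc ∫⁻ x, ‖f x‖ₑ ^ p ∂μ
        ≤ ∫⁻ x, ENNReal.ofReal ((p / (2 * c)) ^ (p / 2)) *
          ENNReal.ofReal (Real.exp (c * f x ^ 2)) ∂μ := by
          refine lintegral_mono fun x => ?_
          rw [← ENNReal.ofReal_mul (by positivity), Real.enorm_eq_ofReal_abs,
            ENNReal.ofReal_rpow_of_nonneg (abs_nonneg _) hp0.le]
          exact ENNReal.ofReal_le_ofReal (abs_rpow_le_mul_exp_sq hc hp0 _)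
      _ ≤ _ := by
          rw [lintegral_const_mul' _ _ ENNReal.ofReal_ne_top, ENNReal.ofReal_mul (by positivity)]
          gcongr
  refine (ENNReal.rpow_le_rpow h1 (by positivity)).trans ?_
  rw [ENNReal.ofReal_rpow_of_nonneg (by positivity) (by positivity)]
  refine ENNReal.ofReal_le_ofReal ?_
  rw [Real.mul_rpow (by positivity) (by positivity), ← Real.rpow_mul (by positivity)]
  have e1 : p / 2 * (1 / p) = 1 / 2 := by field_simp
  have e2 : M ^ (1 / p) ≤ M := by
    conv_rhs => rw [← Real.rpow_one M]
    exact Real.rpow_le_rpow_of_exponent_le hM (by rw [div_le_one hp0]; exact hp)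
  rw [e1, Real.div_rpow hp0.le (by positivity), Real.rpow_neg (by positivity)]
  calc p ^ (1 / 2 : ℝ) / (2 * c) ^ (1 / 2 : ℝ) * M ^ (1 / p)
      ≤ p ^ (1 / 2 : ℝ) / (2 * c) ^ (1 / 2 : ℝ) * M := by gcongr
    _ = _ := by field_simp

/-! ### Shifts in $L^p$: from dyadic to arbitrary. -/

lemma measurableSet_shiftDomain (h : ℝ) : MeasurableSet (shiftDomain h) :=
  measurableSet_Ioo.inter (measurableSet_Ioo.preimage (measurable_id.add_const h))

lemma shiftDomain_eq_Ioo {h : ℝ} (hh : 0 ≤ h) : shiftDomain h = Ioo 0 (1 - h) := by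
  ext s
  simp only [shiftDomain, mem_ofPred_eq, mem_Ioo]
  constructor
  · rintro ⟨⟨a, b⟩, c, d⟩; exact ⟨a, by linarith⟩
  · rintro ⟨a, b⟩; exact ⟨⟨a, by linarith⟩, by linarith, by linarith⟩

lemma eLpNorm_comp_add_right_restrict_le {g : ℝ → ℝ} (hg : Measurable g) (p : ℝ≥0∞) (a : ℝ)
    {s t : Set ℝ} (ht : MeasurableSet t) (hst : ∀ x ∈ s, x + a ∈ t) :
    eLpNorm (fun x => g (x + a)) p (volume.restrict s) ≤ eLpNorm g p (volume.restrict t) := by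
  have hmp := (measurePreserving_add_right (volume : Measure ℝ) a).restrict_preimage ht
  rw [← eLpNorm_comp_measurePreserving hg.aestronglyMeasurable hmp]
  exact eLpNorm_mono_measure _ (Measure.restrict_mono_set _ hst)

lemma eLpNorm_add_shift_le {f : ℝ → ℝ} (hf : Measurable f) {p : ℝ≥0∞} (hp : 1 ≤ p) {a b : ℝ}
    (ha : 0 ≤ a) (hb : 0 ≤ b) :
    eLpNorm (fun s => f (s + (a + b)) - f s) p (volume.restrict (shiftDomain (a + b))) ≤
      eLpNorm (fun s => f (s + a) - f s) p (volume.restrict (shiftDomain a)) +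
      eLpNorm (fun s => f (s + b) - f s) p (volume.restrict (shiftDomain b)) := by
  have e : (fun s => f (s + (a + b)) - f s) =
      (fun s => f (s + a) - f s) + fun s => (fun x => f (x + b) - f x) (s + a) := by
    ext s; simp [add_assoc]
  rw [e]
  refine (eLpNorm_add_le (by fun_prop) (by fun_prop) hp).trans (add_le_add ?_ ?_)
  · refine eLpNorm_mono_measure _ (Measure.restrict_mono_set _ ?_)
    rw [shiftDomain_eq_Ioo ha, shiftDomain_eq_Ioo (by positivity)]
    exact Ioo_subset_Ioo_right (by linarith)
  · refine eLpNorm_comp_add_right_restrict_le (g := fun x => f (x + b) - f x) (by fun_prop) p a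
      (measurableSet_shiftDomain b) fun x hx => ?_
    rw [shiftDomain_eq_Ioo (by positivity)] at hx ⊢
    exact ⟨by linarith [hx.1], by linarith [hx.2]⟩

/-- Induction on the number of binary digits of the shift: an even $k$ adds no new digit, an odd $k$
adds one shift by $2^{-(m+i+1)}$. Each dyadic scale is thus used at most once. -/
lemma eLpNorm_dyadic_shift_le {f : ℝ → ℝ} (hf : Measurable f) {p : ℝ≥0∞} (hp : 1 ≤ p)
    {a : ℕ → ℝ≥0∞}
    (h : ∀ n, eLpNorm (fun s => f (s + (1 / 2) ^ (n + 1)) - f s) p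
      (volume.restrict (shiftDomain ((1 / 2) ^ (n + 1)))) ≤ a n)
    (m i k : ℕ) (hk : k < 2 ^ i) :
    eLpNorm (fun s => f (s + k / 2 ^ (m + i)) - f s) p
      (volume.restrict (shiftDomain (k / 2 ^ (m + i)))) ≤ ∑ l ∈ Finset.range i, a (m + l) := by
  induction i generalizing k with
  | zero =>
    obtain rfl : k = 0 := by simpa using hk
    simp
  | succ i ih =>
    rw [Finset.sum_range_succ]
    obtain ⟨r, rfl | rfl⟩ := k.even_or_odd'
    · have e : ((2 * r : ℕ) : ℝ) / 2 ^ (m + (i + 1)) = r / 2 ^ (m + i) := by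
        push_cast; rw [← add_assoc, pow_succ]; field_simp
      rw [e]
      exact (ih r (by rw [pow_succ] at hk; omega)).trans le_self_add
    · have e : ((2 * r + 1 : ℕ) : ℝ) / 2 ^ (m + (i + 1)) =
          r / 2 ^ (m + i) + (1 / 2) ^ (m + i + 1) := by
        push_cast; rw [← add_assoc, pow_succ, pow_succ, one_div_pow]; field_simp
      rw [e]
      exact (eLpNorm_add_shift_le hf hp (by positivity) (by positivity)).trans
        (add_le_add (ih r (by rw [pow_succ] at hk; omega)) (h _))

lemma tendsto_eLpNorm_translate {g : ℝ → ℝ} {p : ℝ≥0∞} (hp : 1 ≤ p) (hp' : p ≠ ∞)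
    (hg : MemLp g p volume) {u : ℕ → ℝ} {h : ℝ} (hu : Tendsto u atTop (𝓝 h)) :
    Tendsto (fun n => eLpNorm (fun s => g (s + h) - g (s + u n)) p volume) atTop (𝓝 0) := by
  have : Fact (1 ≤ p) := ⟨hp⟩
  have : Fact (p ≠ ∞) := ⟨hp'⟩
  have h1 : Tendsto (fun n => DomAddAct.mk (u n) +ᵥ hg.toLp g) atTop
      (𝓝 (DomAddAct.mk h +ᵥ hg.toLp g)) :=
    ((DomAddAct.continuous_mk.tendsto h).comp hu).vadd tendsto_const_nhds
  simp only [DomAddAct.mk_vadd_toLp] at h1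
  rw [Lp.tendsto_Lp_iff_tendsto_eLpNorm''] at h1
  refine h1.congr fun n => ?_
  rw [eLpNorm_sub_comm]
  simp [vadd_eq_add, add_comm]
  rfl

lemma eLpNorm_shift_le_of_dyadic {f : ℝ → ℝ} (hf : Measurable f) {p : ℝ≥0∞} (hp : 1 ≤ p)
    (hp' : p ≠ ∞) (hfp : MemLp f p (volume.restrict (Ioo 0 1))) {A H : ℝ} (hA : 0 ≤ A) (hH : 0 < H)
    (hd : ∀ n : ℕ, eLpNorm (fun s => f (s + (1 / 2) ^ (n + 1)) - f s) p
      (volume.restrict (shiftDomain ((1 / 2) ^ (n + 1)))) ≤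
        ENNReal.ofReal (A * (((1 / 2 : ℝ) ^ (n + 1)) ^ H)))
    {h : ℝ} (h0 : 0 < h) (h1 : h < 1) :
    eLpNorm (fun s => f (s + h) - f s) p (volume.restrict (shiftDomain h)) ≤
      ENNReal.ofReal (A / (1 - (1 / 2) ^ H) * h ^ H) := by
  set q : ℝ := (1 / 2) ^ H with hq
  have hq0 : 0 < q := by positivity
  have hq1 : q < 1 := Real.rpow_lt_one (by norm_num) (by norm_num) hH
  have hqn (n : ℕ) : ((1 / 2 : ℝ) ^ n) ^ H = q ^ n := by
    rw [hq, ← Real.rpow_natCast, ← Real.rpow_mul (by norm_num), mul_comm, Real.rpow_mul (by norm_num),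
      Real.rpow_natCast]
  obtain ⟨m, hm1, hm2⟩ : ∃ m : ℕ, (1 / 2 : ℝ) ^ (m + 1) ≤ h ∧ h < (1 / 2) ^ m := by
    obtain ⟨m, hm1, hm2⟩ := exists_nat_pow_near_of_lt_one h0 h1.le (y := (1 / 2 : ℝ))
      (by norm_num) (by norm_num)
    -- The inequality $h<2^{-m}$ must be strict, so that the truncations of $h$ have numerator below
    -- $2^i$; when $h$ is itself a dyadic power, the next coarser scale is taken.
    rcases hm2.lt_or_eq with hlt | rfl
    · exact ⟨m, hm1.le, hlt⟩
    · cases m with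
      | zero => norm_num at h1
      | succ m => exact ⟨m, le_rfl, pow_lt_pow_right_of_lt_one₀ (by norm_num) (by norm_num) (by omega)⟩
  set u : ℕ → ℝ := fun i => (⌊h * 2 ^ (m + i)⌋₊ : ℝ) / 2 ^ (m + i) with hu
  have hut : Tendsto u atTop (𝓝 h) := by
    refine (tendsto_nat_floor_mul_div_atTop h0.le).comp
      ((tendsto_pow_atTop_atTop_of_one_lt (by norm_num : (1 : ℝ) < 2)).comp
        (tendsto_add_atTop_nat m)) |>.congr fun i => ?_
    simp [hu, add_comm m i]
  have hu0 (i : ℕ) : 0 ≤ u i := by positivity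
  have huh (i : ℕ) : u i ≤ h := by
    rw [hu, div_le_iff₀ (by positivity)]
    exact Nat.floor_le (by positivity)
  have hbound (i : ℕ) : eLpNorm (fun s => f (s + u i) - f s) p (volume.restrict (shiftDomain h)) ≤
      ENNReal.ofReal (A / (1 - q) * h ^ H) := by
    have hk : ⌊h * 2 ^ (m + i)⌋₊ < 2 ^ i := by
      rw [Nat.floor_lt (by positivity)]
      push_cast
      calc h * 2 ^ (m + i) < (1 / 2) ^ m * 2 ^ (m + i) := by gcongr
        _ = 2 ^ i := by rw [pow_add, one_div_pow]; field_simp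
    refine (eLpNorm_mono_measure _ (Measure.restrict_mono_set _ ?_)).trans
      ((eLpNorm_dyadic_shift_le hf hp hd m i _ hk).trans ?_)
    · change shiftDomain h ⊆ shiftDomain (u i)
      rw [shiftDomain_eq_Ioo h0.le, shiftDomain_eq_Ioo (hu0 i)]
      exact Ioo_subset_Ioo_right (by linarith [huh i])
    · rw [← ENNReal.ofReal_sum_of_nonneg (fun _ _ => by positivity)]
      refine ENNReal.ofReal_le_ofReal ?_
      have e : ∑ l ∈ Finset.range i, A * ((1 / 2 : ℝ) ^ (m + l + 1)) ^ H =
          A * q ^ (m + 1) * ∑ l ∈ Finset.range i, q ^ l := by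
        rw [Finset.mul_sum]
        refine Finset.sum_congr rfl fun l _ => ?_
        rw [hqn]; ring
      have hg : ∑ l ∈ Finset.range i, q ^ l ≤ (1 - q)⁻¹ :=
        tsum_geometric_of_lt_one hq0.le hq1 ▸
          (summable_geometric_of_lt_one hq0.le hq1).sum_le_tsum _ fun l _ => by positivity
      have hqh : q ^ (m + 1) ≤ h ^ H := by
        rw [← hqn]
        exact Real.rpow_le_rpow (by positivity) hm1 hH.le
      rw [e]
      calc A * q ^ (m + 1) * ∑ l ∈ Finset.range i, q ^ l ≤ A * h ^ H * (1 - q)⁻¹ := by gcongr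
        _ = _ := by ring
  -- Extension by zero makes continuity of translation in $L^p(\mathbb R)$ available. For $s\in
  -- I(h)$ both $s+h$ and $s+u_i$ lie in $(0,1)$ because $0\le u_i\le h$, so the extension is
  -- invisible there.
  have hg : MemLp ((Ioo (0 : ℝ) 1).indicator f) p volume :=
    (memLp_indicator_iff_restrict measurableSet_Ioo).2 hfp
  have hlim := (tendsto_eLpNorm_translate hp hp' hg hut).const_add
    (ENNReal.ofReal (A / (1 - q) * h ^ H))
  rw [add_zero] at hlim
  refine ge_of_tendsto' hlim fun i => ?_
  have e : (fun s => f (s + h) - f s) =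
      (fun s => f (s + u i) - f s) + fun s => f (s + h) - f (s + u i) := by
    ext s; simp
  rw [e]
  refine (eLpNorm_add_le (by fun_prop) (by fun_prop) hp).trans (add_le_add (hbound i) ?_)
  refine le_trans ?_ (eLpNorm_mono_measure _ (Measure.restrict_le_self (s := shiftDomain h)))
  refine (eLpNorm_congr_ae ?_).le
  filter_upwards [ae_restrict_mem (measurableSet_shiftDomain h)] with s hs
  rw [shiftDomain_eq_Ioo h0.le] at hs
  have h2 := hu0 i
  have h3 := huh i
  rw [indicator_of_mem (show s + h ∈ Ioo (0 : ℝ) 1 from ⟨by linarith [hs.1], by linarith [hs.2]⟩),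
    indicator_of_mem (show s + u i ∈ Ioo (0 : ℝ) 1 from ⟨by linarith [hs.1], by linarith [hs.2]⟩)]

lemma eLpNorm_neg_shift (f : ℝ → ℝ) (hf : Measurable f) (p : ℝ≥0∞) (h : ℝ) :
    eLpNorm (fun s => f (s + -h) - f s) p (volume.restrict (shiftDomain (-h))) ≤
      eLpNorm (fun s => f (s + h) - f s) p (volume.restrict (shiftDomain h)) := by
  have e : (fun s => f (s + -h) - f s) =
      -fun s => (fun x => f (x + h) - f x) (s + -h) := by
    ext s; simp
  rw [e, eLpNorm_neg]
  refine eLpNorm_comp_add_right_restrict_le (g := fun x => f (x + h) - f x) (by fun_prop) p (-h) (measurableSet_shiftDomain h)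
    fun x hx => ⟨hx.2, by simpa using hx.1⟩

/-! ### Criteria for membership in the Besov–Orlicz space. -/

lemma expOrliczNorm_two_le {f : ℝ → ℝ} {s : Set ℝ} {C : ℝ}
    (h : ∀ p : ℝ, 1 ≤ p → eLpNorm f (ENNReal.ofReal p) (volume.restrict s) ≤
      ENNReal.ofReal (C * p ^ (1 / 2 : ℝ))) :
    expOrliczNorm 2 f s ≤ ENNReal.ofReal C := by
  refine iSup₂_le fun p hp => ?_
  have hp0 : 0 < p := by linarith
  refine (mul_le_mul_right (h p hp) _).trans_eq ?_
  rw [← ENNReal.ofReal_mul (by positivity), mul_left_comm, ← Real.rpow_add hp0]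
  simp

lemma mem_besovOrliczSpace_of_dyadic {f : ℝ → ℝ} (hf : Measurable f) {H B A : ℝ} (hH : 0 < H)
    (hA : 0 ≤ A)
    (h0 : ∀ p : ℝ, 1 ≤ p → eLpNorm f (ENNReal.ofReal p) (volume.restrict (Ioo 0 1)) ≤
      ENNReal.ofReal (B * p ^ (1 / 2 : ℝ)))
    (hd : ∀ p : ℝ, 1 ≤ p → ∀ n : ℕ,
      eLpNorm (fun s => f (s + (1 / 2) ^ (n + 1)) - f s) (ENNReal.ofReal p)
      (volume.restrict (shiftDomain ((1 / 2) ^ (n + 1)))) ≤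
        ENNReal.ofReal (A * p ^ (1 / 2 : ℝ) * (((1 / 2 : ℝ) ^ (n + 1)) ^ H))) :
    f ∈ BesovOrliczSpace H 2 := by
  refine ⟨hf.aemeasurable, (expOrliczNorm_two_le h0).trans_lt ENNReal.ofReal_lt_top, ?_⟩
  have hq1 : (1 / 2 : ℝ) ^ H < 1 := Real.rpow_lt_one (by norm_num) (by norm_num) hH
  have hq1' : 0 < 1 - (1 / 2 : ℝ) ^ H := by linarith
  set K : ℝ := A / (1 - (1 / 2) ^ H) with hK
  have hK0 : 0 ≤ K := by positivity
  have hpos (h : ℝ) (hh0 : 0 ≤ h) (hh1 : h ≤ 1) (p : ℝ) (hp : 1 ≤ p) :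
      eLpNorm (fun s => f (s + h) - f s) (ENNReal.ofReal p) (volume.restrict (shiftDomain h)) ≤
        ENNReal.ofReal (K * h ^ H * p ^ (1 / 2 : ℝ)) := by
    rcases hh0.eq_or_lt with rfl | hh0
    · simp
    -- At $h=1$ the domain $I(h)$ is empty.
    rcases hh1.eq_or_lt with rfl | hh1
    · simp [shiftDomain_eq_Ioo]
    have := eLpNorm_shift_le_of_dyadic hf (ENNReal.one_le_ofReal.2 hp) ENNReal.ofReal_ne_top
      ⟨by fun_prop, (h0 p hp).trans_lt ENNReal.ofReal_lt_top⟩ (by positivity) hH (hd p hp) hh0 hh1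
    refine this.trans_eq (congrArg _ ?_)
    rw [hK]; ring
  refine lt_of_le_of_lt (iSup₂_le fun t ht => ?_) (ENNReal.ofReal_lt_top (r := K))
  have hmod : orliczModulus 2 f t ≤ ENNReal.ofReal (K * t ^ H) := by
    refine iSup₂_le fun h hh => ?_
    have hle : K * |h| ^ H ≤ K * t ^ H := by gcongr
    refine (expOrliczNorm_two_le (C := K * |h| ^ H) fun p hp => ?_).trans
      (ENNReal.ofReal_le_ofReal hle)
    have := hpos |h| (abs_nonneg _) (hh.trans ht.2) p hp
    rcases abs_choice h with e | e
    · rwa [e] at this ⊢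
    · rw [e] at this ⊢
      have h2 := eLpNorm_neg_shift f hf (ENNReal.ofReal p) (-h)
      rw [neg_neg] at h2
      exact h2.trans this
  refine (mul_le_mul_right hmod _).trans_eq ?_
  rw [← ENNReal.ofReal_mul (by have := ht.1; positivity), mul_left_comm, ← Real.rpow_add ht.1]
  simp

/-- Lets a path be replaced by that of a jointly measurable version. Translations preserve null
sets, so each increment changes only on a null set. -/
lemma mem_besovOrliczSpace_congr {f g : ℝ → ℝ} {α β : ℝ}
    (hfg : f =ᵐ[volume.restrict (Ioo (0 : ℝ) 1)] g) (hg : g ∈ BesovOrliczSpace α β) :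
    f ∈ BesovOrliczSpace α β := by
  have hshift (h : ℝ) : (fun s => f (s + h) - f s) =ᵐ[volume.restrict (shiftDomain h)]
      fun s => g (s + h) - g s := by
    rw [Filter.EventuallyEq, ae_restrict_iff' measurableSet_Ioo] at hfg
    have h2 := (measurePreserving_add_right (volume : Measure ℝ) h).quasiMeasurePreserving.ae hfg
    rw [Filter.EventuallyEq, ae_restrict_iff' (measurableSet_shiftDomain h)]
    filter_upwards [hfg, h2] with s h3 h4 hs
    rw [h3 hs.1, h4 hs.2]
  have e1 : expOrliczNorm β f (Ioo 0 1) = expOrliczNorm β g (Ioo 0 1) := by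
    unfold expOrliczNorm
    simp_rw [fun p => eLpNorm_congr_ae (p := p) hfg]
  have e2 : besovOrliczSeminorm α β f = besovOrliczSeminorm α β g := by
    unfold besovOrliczSeminorm orliczModulus expOrliczNorm
    simp_rw [fun h p => eLpNorm_congr_ae (p := p) (hshift h)]
  exact ⟨hg.1.congr hfg.symm, e1 ▸ hg.2.1, e2 ▸ hg.2.2⟩

lemma mem_besovOrliczSpace_of_lintegral_exp_sq {f : ℝ → ℝ} (hf : Measurable f) {H c M : ℝ}
    (hH : 0 < H) (hc : 0 < c) (hM : 1 ≤ M)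
    (h0 : ∫⁻ s in Ioo (0 : ℝ) 1, ENNReal.ofReal (Real.exp (c * f s ^ 2)) ≤ ENNReal.ofReal M)
    (hd : ∀ n : ℕ, ∫⁻ s in shiftDomain ((1 / 2) ^ (n + 1)), ENNReal.ofReal (Real.exp
      (c * ((f (s + (1 / 2) ^ (n + 1)) - f s) / ((1 / 2) ^ (n + 1)) ^ H) ^ 2)) ≤
        ENNReal.ofReal M) :
    f ∈ BesovOrliczSpace H 2 := by
  refine mem_besovOrliczSpace_of_dyadic hf hH (B := (2 * c) ^ (-(1 / 2) : ℝ) * M)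
    (A := (2 * c) ^ (-(1 / 2) : ℝ) * M) (by positivity)
    (fun p hp => eLpNorm_le_of_lintegral_exp_sq_le hc hM hp h0) fun p hp n => ?_
  set d : ℝ := (1 / 2) ^ (n + 1) with hd'
  have hd0 : 0 < d ^ H := by positivity
  have := eLpNorm_le_of_lintegral_exp_sq_le hc hM hp (hd n)
  have e : (fun s => f (s + d) - f s) = (d ^ H) • fun s => (f (s + d) - f s) / d ^ H := by
    ext s; simp; field_simp
  rw [e, eLpNorm_const_smul, mul_comm, ENNReal.ofReal_mul (by positivity), Real.enorm_eq_ofReal hd0.le]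
  gcongr

end BesovOrlicz

/-! ### Exponential moments of squares of Gaussian variables. -/

section GaussianProcesses

open Filter Topology

variable {Ω : Type*} [MeasurableSpace Ω] {P : Measure Ω}

lemma lintegral_exp_of_hasGaussianLaw {X : Ω → ℝ} (hX : HasGaussianLaw X P)
    (h0 : ∫ ω, X ω ∂P = 0) :
    ∫⁻ ω, ENNReal.ofReal (Real.exp (X ω)) ∂P = ENNReal.ofReal (Real.exp (Var[X; P] / 2)) := by
  have h1 := hX.map_eq_gaussianReal
  rw [h0] at h1
  have h2 := mgf_gaussianReal h1 1
  have : NeZero P := ⟨hX.isProbabilityMeasure.ne_zero⟩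
  have h3 : Integrable (fun ω => Real.exp (1 * X ω)) P := by
    rw [← mgf_pos_iff, h2]
    exact Real.exp_pos _
  simp only [mgf, one_mul, zero_add, one_pow, mul_one,
    Real.coe_toNNReal _ (variance_nonneg _ _)] at h2 h3
  rw [← ofReal_integral_eq_lintegral_ofReal h3 (ae_of_all _ fun _ => (Real.exp_pos _).le), h2]

lemma lintegral_exp_mul_gaussianReal (t : ℝ) :
    ∫⁻ z, ENNReal.ofReal (Real.exp (t * z)) ∂(gaussianReal 0 1) =
      ENNReal.ofReal (Real.exp (t ^ 2 / 2)) := by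
  rw [← ofReal_integral_eq_lintegral_ofReal (integrable_exp_mul_gaussianReal t)
    (ae_of_all _ fun _ => (Real.exp_pos _).le)]
  have := congrFun (mgf_fun_id_gaussianReal (μ := 0) (v := 1)) t
  simp only [mgf] at this
  rw [this]
  simp

lemma exists_lintegral_exp_sq_gaussianReal_lt_top :
    ∃ C : ℝ, 0 < C ∧ ∫⁻ z, ENNReal.ofReal (Real.exp (C * z ^ 2)) ∂(gaussianReal 0 1) < ∞ := by
  obtain ⟨C, hC, h⟩ := IsGaussian.exists_integrable_exp_sq (gaussianReal 0 1)
  refine ⟨C, hC, ?_⟩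
  simp only [Real.norm_eq_abs, sq_abs] at h
  exact (hasFiniteIntegral_iff_ofReal (ae_of_all _ fun _ => (Real.exp_pos _).le)).1 h.2

/-- Linearise the square by an independent standard Gaussian, $e^{cx^2}=\mathbb
E\,e^{\sqrt{2c}\,xZ}$, and exchange the integrals by Tonelli; only the Laplace transform of $X$ is
then needed. -/
lemma lintegral_exp_sq_eq [SFinite P] {X : Ω → ℝ} (hX : Measurable X) {a c : ℝ} (hc : 0 ≤ c)
    (h : ∀ z : ℝ, ∫⁻ ω, ENNReal.ofReal (Real.exp (z * X ω)) ∂P =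
      ENNReal.ofReal (Real.exp (a * z ^ 2 / 2))) :
    ∫⁻ ω, ENNReal.ofReal (Real.exp (c * X ω ^ 2)) ∂P =
      ∫⁻ z, ENNReal.ofReal (Real.exp (c * a * z ^ 2)) ∂(gaussianReal 0 1) := by
  have hs : √(2 * c) ^ 2 = 2 * c := Real.sq_sqrt (by positivity)
  calc ∫⁻ ω, ENNReal.ofReal (Real.exp (c * X ω ^ 2)) ∂P
      = ∫⁻ ω, ∫⁻ z, ENNReal.ofReal (Real.exp (√(2 * c) * X ω * z)) ∂(gaussianReal 0 1) ∂P := by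
        refine lintegral_congr fun ω => ?_
        rw [lintegral_exp_mul_gaussianReal, mul_pow, hs]
        ring_nf
    _ = ∫⁻ z, ∫⁻ ω, ENNReal.ofReal (Real.exp (√(2 * c) * X ω * z)) ∂P ∂(gaussianReal 0 1) :=
        lintegral_lintegral_swap (by fun_prop)
    _ = _ := by
        refine lintegral_congr fun z => ?_
        have := h (√(2 * c) * z)
        rw [mul_pow, hs] at this
        simp_rw [show ∀ ω, √(2 * c) * X ω * z = √(2 * c) * z * X ω from fun ω => by ring]
        rw [this]
        ring_nf

/-- With $\theta=|r|/K\le1$ and $x=cK(z^2+w^2)$ the cross term is at most $\theta x$, and convexity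
gives $e^{\theta x}\le 1+\theta e^x$. The $1$ leaves the decoupled product; the rest carries the
small factor $\theta$. -/
lemma exp_quadratic_form_le {K a b r c : ℝ} (hK : 0 < K) (hc : 0 ≤ c) (ha : a ≤ K) (hb : b ≤ K)
    (hr : |r| ≤ K) (z w : ℝ) :
    Real.exp (c * (a * z ^ 2 + 2 * r * z * w + b * w ^ 2)) ≤
      Real.exp (c * a * z ^ 2) * Real.exp (c * b * w ^ 2) +
        |r| / K * (Real.exp (2 * c * K * z ^ 2) * Real.exp (2 * c * K * w ^ 2)) := by
  set x : ℝ := c * K * (z ^ 2 + w ^ 2) with hx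
  set θ : ℝ := |r| / K with hθ
  have hθ0 : 0 ≤ θ := by positivity
  have hθ1 : θ ≤ 1 := (div_le_one hK).2 hr
  have hrK : |r| = θ * K := by rw [hθ]; field_simp
  have h1 : Real.exp (2 * c * r * z * w) ≤ 1 + θ * Real.exp x := by
    have h2 : 2 * c * r * z * w ≤ θ * x := by
      have : r * (2 * z * w) ≤ |r| * (z ^ 2 + w ^ 2) := by
        refine (le_abs_self _).trans ?_
        rw [abs_mul]
        gcongr
        rw [abs_le]
        constructor <;> nlinarith [sq_nonneg (z + w), sq_nonneg (z - w)]
      calc 2 * c * r * z * w = c * (r * (2 * z * w)) := by ring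
        _ ≤ c * (|r| * (z ^ 2 + w ^ 2)) := by gcongr
        _ = θ * x := by rw [hrK, hx]; ring
    have h3 : Real.exp (θ * x) ≤ (1 - θ) * Real.exp 0 + θ * Real.exp x := by
      have := convexOn_exp.2 (mem_univ 0) (mem_univ x) (sub_nonneg.2 hθ1) hθ0 (by ring)
      simpa using this
    rw [Real.exp_zero] at h3
    linarith [Real.exp_le_exp.2 h2]
  have h4 : Real.exp (c * a * z ^ 2) * Real.exp (c * b * w ^ 2) ≤ Real.exp x := by
    rw [← Real.exp_add, Real.exp_le_exp, hx]
    have : c * a * z ^ 2 ≤ c * K * z ^ 2 := by gcongr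
    have : c * b * w ^ 2 ≤ c * K * w ^ 2 := by gcongr
    linarith
  calc Real.exp (c * (a * z ^ 2 + 2 * r * z * w + b * w ^ 2))
      = Real.exp (c * a * z ^ 2) * Real.exp (c * b * w ^ 2) * Real.exp (2 * c * r * z * w) := by
        rw [← Real.exp_add, ← Real.exp_add]; ring_nf
    _ ≤ Real.exp (c * a * z ^ 2) * Real.exp (c * b * w ^ 2) * (1 + θ * Real.exp x) := by gcongr
    _ = Real.exp (c * a * z ^ 2) * Real.exp (c * b * w ^ 2) +
        θ * (Real.exp (c * a * z ^ 2) * Real.exp (c * b * w ^ 2) * Real.exp x) := by ring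
    _ ≤ Real.exp (c * a * z ^ 2) * Real.exp (c * b * w ^ 2) +
        θ * (Real.exp x * Real.exp x) := by gcongr
    _ = _ := by
        rw [← Real.exp_add, ← Real.exp_add, ← Real.exp_add, hx]; ring_nf

/-- Both squares are linearised by independent Gaussians. Integrating over $\omega$ leaves the
exponential of a quadratic form, whose decoupled part integrates to the product of the two means. -/
lemma lintegral_exp_sq_mul_exp_sq_le [SFinite P] {X Y : Ω → ℝ} (hX : Measurable X)
    (hY : Measurable Y) {K a b r c : ℝ} (hK : 0 < K) (hc : 0 ≤ c) (ha : a ≤ K) (hb : b ≤ K)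
    (hr : |r| ≤ K)
    (h : ∀ z w : ℝ, ∫⁻ ω, ENNReal.ofReal (Real.exp (z * X ω + w * Y ω)) ∂P =
      ENNReal.ofReal (Real.exp ((a * z ^ 2 + 2 * r * z * w + b * w ^ 2) / 2))) :
    ∫⁻ ω, ENNReal.ofReal (Real.exp (c * X ω ^ 2)) * ENNReal.ofReal (Real.exp (c * Y ω ^ 2)) ∂P ≤
      (∫⁻ ω, ENNReal.ofReal (Real.exp (c * X ω ^ 2)) ∂P) *
        (∫⁻ ω, ENNReal.ofReal (Real.exp (c * Y ω ^ 2)) ∂P) +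
      ENNReal.ofReal (|r| / K) *
        (∫⁻ z, ENNReal.ofReal (Real.exp (2 * c * K * z ^ 2)) ∂(gaussianReal 0 1)) ^ 2 := by
  have hs : √(2 * c) ^ 2 = 2 * c := Real.sq_sqrt (by positivity)
  set γ := gaussianReal 0 1 with hγ
  have h1 := lintegral_exp_sq_eq hX hc (a := a) fun z => by simpa using h z 0
  have h2 := lintegral_exp_sq_eq hY hc (a := b) fun z => by simpa using h 0 z
  rw [h1, h2]
  calc ∫⁻ ω, ENNReal.ofReal (Real.exp (c * X ω ^ 2)) * ENNReal.ofReal (Real.exp (c * Y ω ^ 2)) ∂P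
      = ∫⁻ ω, ∫⁻ q, ENNReal.ofReal (Real.exp (√(2 * c) * q.1 * X ω + √(2 * c) * q.2 * Y ω))
          ∂(γ.prod γ) ∂P := by
        refine lintegral_congr fun ω => ?_
        have e (x : ℝ) : ENNReal.ofReal (Real.exp (c * x ^ 2)) =
            ∫⁻ z, ENNReal.ofReal (Real.exp (√(2 * c) * x * z)) ∂γ := by
          rw [lintegral_exp_mul_gaussianReal, mul_pow, hs]
          ring_nf
        rw [e, e, ← lintegral_prod_mul (by fun_prop) (by fun_prop)]
        refine lintegral_congr fun q => ?_
        rw [← ENNReal.ofReal_mul (Real.exp_pos _).le, ← Real.exp_add]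
        ring_nf
    _ = ∫⁻ q, ∫⁻ ω, ENNReal.ofReal (Real.exp (√(2 * c) * q.1 * X ω + √(2 * c) * q.2 * Y ω)) ∂P
          ∂(γ.prod γ) := lintegral_lintegral_swap (by fun_prop)
    _ ≤ ∫⁻ q, (ENNReal.ofReal (Real.exp (c * a * q.1 ^ 2)) *
            ENNReal.ofReal (Real.exp (c * b * q.2 ^ 2)) +
          ENNReal.ofReal (|r| / K) * (ENNReal.ofReal (Real.exp (2 * c * K * q.1 ^ 2)) *
            ENNReal.ofReal (Real.exp (2 * c * K * q.2 ^ 2)))) ∂(γ.prod γ) := by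
        refine lintegral_mono fun q => ?_
        have e : (a * (√(2 * c) * q.1) ^ 2 + 2 * r * (√(2 * c) * q.1) * (√(2 * c) * q.2) +
            b * (√(2 * c) * q.2) ^ 2) / 2 =
            c * (a * q.1 ^ 2 + 2 * r * q.1 * q.2 + b * q.2 ^ 2) := by
          linear_combination (a * q.1 ^ 2 + 2 * r * q.1 * q.2 + b * q.2 ^ 2) / 2 * hs
        rw [h, e, ← ENNReal.ofReal_mul (Real.exp_pos _).le, ← ENNReal.ofReal_mul (Real.exp_pos _).le,
          ← ENNReal.ofReal_mul (by positivity), ← ENNReal.ofReal_add (by positivity) (by positivity)]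
        exact ENNReal.ofReal_le_ofReal (exp_quadratic_form_le hK hc ha hb hr _ _)
    _ = _ := by
        rw [lintegral_add_left (by fun_prop), lintegral_const_mul _ (by fun_prop),
          lintegral_prod_mul (f := fun z => ENNReal.ofReal (Real.exp (c * a * z ^ 2)))
            (g := fun z => ENNReal.ofReal (Real.exp (c * b * z ^ 2))) (by fun_prop) (by fun_prop),
          lintegral_prod_mul (f := fun z => ENNReal.ofReal (Real.exp (2 * c * K * z ^ 2)))
            (g := fun z => ENNReal.ofReal (Real.exp (2 * c * K * z ^ 2)))
            (by fun_prop) (by fun_prop), sq]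

lemma lintegral_exp_sq_le [SFinite P] {X : Ω → ℝ} (hX : Measurable X) {a c K : ℝ} (hc : 0 ≤ c)
    (ha : a ≤ 2 * K)
    (h : ∀ z : ℝ, ∫⁻ ω, ENNReal.ofReal (Real.exp (z * X ω)) ∂P =
      ENNReal.ofReal (Real.exp (a * z ^ 2 / 2))) :
    ∫⁻ ω, ENNReal.ofReal (Real.exp (c * X ω ^ 2)) ∂P ≤
      ∫⁻ z, ENNReal.ofReal (Real.exp (2 * c * K * z ^ 2)) ∂(gaussianReal 0 1) := by
  rw [lintegral_exp_sq_eq hX hc h]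
  refine lintegral_mono fun z => ENNReal.ofReal_le_ofReal (Real.exp_le_exp.2 ?_)
  have : c * a * z ^ 2 ≤ c * (2 * K) * z ^ 2 := by gcongr
  linarith

/-! ### Second moments and almost sure bounds. -/

lemma tsub_sq_add_le (x m : ℝ≥0∞) : (x - m) ^ 2 + 2 * m * x ≤ x ^ 2 + m ^ 2 := by
  rcases eq_or_ne x ∞ with rfl | hx
  · simp
  rcases le_total x m with h | h
  · rw [tsub_eq_zero_of_le h]
    rcases eq_or_ne m ∞ with rfl | hm
    · simp
    lift x to ℝ≥0 using hx
    lift m to ℝ≥0 using hm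
    norm_cast
    rw [← NNReal.coe_le_coe]
    push_cast
    nlinarith [sq_nonneg ((x : ℝ) - m)]
  · obtain ⟨d, rfl⟩ := exists_add_of_le h
    rw [ENNReal.add_sub_cancel_left (ne_top_of_le_ne_top hx h)]
    exact le_of_eq (by ring)

/-- Chebyshev-type variance computation. Only upward deviations matter, so truncated subtraction
suffices and no integrability of the square is required beforehand. -/
lemma lintegral_tsub_sq_le [IsProbabilityMeasure P] {α : Type*} [MeasurableSpace α]
    {μ : Measure α} [SFinite μ] {φ : α → Ω → ℝ≥0∞} (hφ : Measurable (Function.uncurry φ))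
    {ρ : α → α → ℝ≥0∞}
    (h : ∀ᵐ s ∂μ, ∀ᵐ t ∂μ, ∫⁻ ω, φ s ω * φ t ω ∂P ≤
      (∫⁻ ω, φ s ω ∂P) * (∫⁻ ω, φ t ω ∂P) + ρ s t)
    (hfin : ∫⁻ ω, ∫⁻ s, φ s ω ∂μ ∂P ≠ ∞) :
    ∫⁻ ω, ((∫⁻ s, φ s ω ∂μ) - ∫⁻ ω, ∫⁻ s, φ s ω ∂μ ∂P) ^ 2 ∂P ≤ ∫⁻ s, ∫⁻ t, ρ s t ∂μ ∂μ := by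
  set m := ∫⁻ ω, ∫⁻ s, φ s ω ∂μ ∂P with hm
  have hφs (s : α) : Measurable (φ s) := hφ.of_uncurry_left
  have hφω (ω : Ω) : Measurable fun s => φ s ω := hφ.of_uncurry_right
  have hG : Measurable fun ω => ∫⁻ s, φ s ω ∂μ :=
    Measurable.lintegral_prod_left' (f := Function.uncurry φ) hφ
  have hmean : Measurable fun s => ∫⁻ ω, φ s ω ∂P :=
    Measurable.lintegral_prod_right' (f := Function.uncurry φ) hφ
  have hm2 : ∫⁻ s, ∫⁻ ω, φ s ω ∂P ∂μ = m := lintegral_lintegral_swap hφ.aemeasurable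
  have hsq : ∫⁻ ω, (∫⁻ s, φ s ω ∂μ) ^ 2 ∂P ≤ m ^ 2 + ∫⁻ s, ∫⁻ t, ρ s t ∂μ ∂μ := by
    calc ∫⁻ ω, (∫⁻ s, φ s ω ∂μ) ^ 2 ∂P
        = ∫⁻ ω, ∫⁻ q, φ q.1 ω * φ q.2 ω ∂(μ.prod μ) ∂P := by
          refine lintegral_congr fun ω => ?_
          rw [sq, ← lintegral_prod_mul (hφω ω).aemeasurable (hφω ω).aemeasurable]
      _ = ∫⁻ q, ∫⁻ ω, φ q.1 ω * φ q.2 ω ∂P ∂(μ.prod μ) :=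
          lintegral_lintegral_swap
            ((hφ.comp (measurable_snd.fst.prodMk measurable_fst)).mul
              (hφ.comp (measurable_snd.snd.prodMk measurable_fst))).aemeasurable
      _ = ∫⁻ s, ∫⁻ t, ∫⁻ ω, φ s ω * φ t ω ∂P ∂μ ∂μ := by
          refine lintegral_prod _ (Measurable.lintegral_prod_right' (f := fun x : (α × α) × Ω =>
            φ x.1.1 x.2 * φ x.1.2 x.2) ?_).aemeasurable
          exact (hφ.comp (measurable_fst.fst.prodMk measurable_snd)).mul
              (hφ.comp (measurable_fst.snd.prodMk measurable_snd))
      _ ≤ ∫⁻ s, ∫⁻ t, ((∫⁻ ω, φ s ω ∂P) * (∫⁻ ω, φ t ω ∂P) + ρ s t) ∂μ ∂μ :=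
          lintegral_mono_ae (h.mono fun s hs => lintegral_mono_ae hs)
      _ = ∫⁻ s, ((∫⁻ ω, φ s ω ∂P) * m + ∫⁻ t, ρ s t ∂μ) ∂μ := by
          refine lintegral_congr fun s => ?_
          rw [lintegral_add_left (hmean.const_mul _), lintegral_const_mul _ hmean, hm2]
      _ = _ := by
          rw [lintegral_add_left (hmean.mul_const _), lintegral_mul_const _ hmean, hm2, sq]
  have hcalc : (∫⁻ ω, ((∫⁻ s, φ s ω ∂μ) - m) ^ 2 ∂P) + 2 * m * m ≤
      (∫⁻ s, ∫⁻ t, ρ s t ∂μ ∂μ) + 2 * m * m := by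
    calc (∫⁻ ω, ((∫⁻ s, φ s ω ∂μ) - m) ^ 2 ∂P) + 2 * m * m
        = ∫⁻ ω, (((∫⁻ s, φ s ω ∂μ) - m) ^ 2 + 2 * m * ∫⁻ s, φ s ω ∂μ) ∂P := by
          rw [lintegral_add_left (by fun_prop), lintegral_const_mul _ hG]
      _ ≤ ∫⁻ ω, ((∫⁻ s, φ s ω ∂μ) ^ 2 + m ^ 2) ∂P := lintegral_mono fun ω => tsub_sq_add_le _ _
      _ = (∫⁻ ω, (∫⁻ s, φ s ω ∂μ) ^ 2 ∂P) + m ^ 2 := by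
          rw [lintegral_add_left (by fun_prop)]; simp
      _ ≤ (m ^ 2 + ∫⁻ s, ∫⁻ t, ρ s t ∂μ ∂μ) + m ^ 2 := by gcongr
      _ = _ := by ring
  exact (ENNReal.add_le_add_iff_right (by finiteness)).1 hcalc

/-- Almost surely $T=\sum_n(G_n-m_n)_+^2$ is finite, and $y\le\max(1,y^2)$ gives $G_n\le 1+T+\kappa$
for every $n$. -/
lemma ae_exists_bound_of_tsum_lintegral_tsub_sq [IsProbabilityMeasure P] {G : ℕ → Ω → ℝ≥0∞}
    (hG : ∀ n, Measurable (G n)) {m : ℕ → ℝ≥0∞} {κ : ℝ≥0∞} (hκ : κ ≠ ∞) (hm : ∀ n, m n ≤ κ)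
    (h : ∑' n, ∫⁻ ω, (G n ω - m n) ^ 2 ∂P ≠ ∞) :
    ∀ᵐ ω ∂P, ∃ M : ℝ, 1 ≤ M ∧ ∀ n, G n ω ≤ ENNReal.ofReal M := by
  rw [← lintegral_tsum (fun n => by fun_prop)] at h
  filter_upwards [ae_lt_top' (by fun_prop) h] with ω hω
  set T := ∑' n, (G n ω - m n) ^ 2 with hT
  have hfin : 1 + T + κ ≠ ∞ := by finiteness
  refine ⟨(1 + T + κ).toReal, ?_, fun n => ?_⟩
  · rw [← ENNReal.toReal_one]
    exact ENNReal.toReal_mono hfin (by rw [add_assoc]; exact le_self_add)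
  · rw [ENNReal.ofReal_toReal hfin]
    have h1 : (G n ω - m n) ^ 2 ≤ T := ENNReal.le_tsum n
    have h2 : G n ω - m n ≤ 1 + T := by
      rcases le_total (G n ω - m n) 1 with h3 | h3
      · exact h3.trans le_self_add
      · exact (le_self_pow h3 two_ne_zero).trans (h1.trans le_add_self)
    calc G n ω ≤ (G n ω - m n) + m n := le_tsub_add
      _ ≤ _ := add_le_add h2 (hm n)

/-! ### Second differences of powers and increment covariances. -/

lemma exists_second_difference_rpow_eq (α : ℝ) {u : ℝ} (hu : 1 < u) :
    ∃ y, u - 1 < y ∧ (u + 1) ^ α + (u - 1) ^ α - 2 * u ^ α = α * (α - 1) * y ^ (α - 2) := by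
  have hd (β x : ℝ) (hx : 0 < x) : HasDerivAt (fun x : ℝ => x ^ β) (β * x ^ (β - 1)) x :=
    Real.hasDerivAt_rpow_const (Or.inl hx.ne')
  have hd1 (x : ℝ) (hx : 0 < x) : HasDerivAt (fun x : ℝ => (x + 1) ^ α - x ^ α)
      (α * (x + 1) ^ (α - 1) - α * x ^ (α - 1)) x :=
    ((hd α (x + 1) (by linarith)).comp_add_const x 1).sub (hd α x hx)
  -- Mean value theorem twice: for $x\mapsto(x+1)^\alpha-x^\alpha$ on $[u-1,u]$, then for $x\mapsto
  -- x^{\alpha-1}$ on $[x,x+1]$.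
  obtain ⟨x, hx, hx'⟩ := exists_hasDerivAt_eq_slope (fun x : ℝ => (x + 1) ^ α - x ^ α) _
    (show u - 1 < u by linarith)
    (fun x hx => (hd1 x (by linarith [hx.1])).continuousAt.continuousWithinAt)
    (fun x hx => hd1 x (by linarith [hx.1]))
  have hx0 : 0 < x := by linarith [hx.1]
  obtain ⟨y, hy, hy'⟩ := exists_hasDerivAt_eq_slope (fun x : ℝ => x ^ (α - 1)) _
    (show x < x + 1 by linarith)
    (fun y hy => (hd (α - 1) y (by linarith [hy.1])).continuousAt.continuousWithinAt)
    (fun y hy => hd (α - 1) y (by linarith [hy.1]))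
  refine ⟨y, by linarith [hy.1, hx.1], ?_⟩
  have e1 : α - 1 - 1 = α - 2 := by ring
  simp only [sub_sub_cancel, div_one, sub_add_cancel, add_sub_cancel_left, e1] at hx' hy'
  rw [mul_assoc, hy']
  linarith

lemma abs_second_difference_rpow_le {α : ℝ} (h0 : 0 ≤ α) (h2 : α ≤ 2) {N u : ℝ} (hN : 1 < N)
    (hu : N ≤ |u|) :
    |(|u + 1| ^ α + |u - 1| ^ α - 2 * |u| ^ α)| ≤ 2 * (N - 1) ^ (α - 2) := by
  have key : ∀ v : ℝ, N ≤ v →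
      |(v + 1) ^ α + (v - 1) ^ α - 2 * v ^ α| ≤ 2 * (N - 1) ^ (α - 2) := by
    intro v hv
    obtain ⟨y, hy, e⟩ := exists_second_difference_rpow_eq α (hN.trans_le hv)
    have hy0 : 0 < y := by linarith
    rw [e, abs_mul, abs_of_nonneg (Real.rpow_nonneg hy0.le _)]
    have h3 : |α * (α - 1)| ≤ 2 := by rw [abs_le]; constructor <;> nlinarith
    have h4 : y ^ (α - 2) ≤ (N - 1) ^ (α - 2) :=
      Real.rpow_le_rpow_of_nonpos (by linarith) (by linarith) (by linarith)
    gcongr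
  have := key |u| hu
  rcases abs_choice u with e | e
  · rw [e] at hu this ⊢
    rwa [abs_of_pos (by linarith : 0 < u + 1), abs_of_pos (by linarith : 0 < u - 1)]
  · rw [e] at hu this ⊢
    rw [abs_of_neg (by linarith : u + 1 < 0), abs_of_neg (by linarith : u - 1 < 0)]
    convert this using 2
    ring_nf

lemma abs_second_difference_rpow_le_const {α : ℝ} (h0 : 0 ≤ α) (h2 : α ≤ 2) (u : ℝ) :
    |(|u + 1| ^ α + |u - 1| ^ α - 2 * |u| ^ α)| ≤ 18 := by
  rcases le_total 2 |u| with h | h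
  · refine (abs_second_difference_rpow_le h0 h2 (by norm_num) h).trans ?_
    norm_num
  · have hb (x : ℝ) (hx : |x| ≤ 3) : |x| ^ α ≤ 9 := by
      calc |x| ^ α ≤ 3 ^ α := by gcongr
        _ ≤ 3 ^ (2 : ℝ) := Real.rpow_le_rpow_of_exponent_le (by norm_num) h2
        _ = 9 := by norm_num
    have h3 := hb (u + 1) (by rw [abs_le] at h ⊢; constructor <;> linarith [h.1, h.2])
    have h4 := hb (u - 1) (by rw [abs_le] at h ⊢; constructor <;> linarith [h.1, h.2])
    have h5 := hb u (by linarith)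
    have h6 : 0 ≤ |u + 1| ^ α := by positivity
    have h7 : 0 ≤ |u - 1| ^ α := by positivity
    have h8 : 0 ≤ |u| ^ α := by positivity
    rw [abs_le]; constructor <;> linarith

/-- The covariance of the increments over `[s, s + h]` and `[t, t + h]` of a sub-fractional
Brownian motion with parameter `H`, normalised by `h ^ (2 * H)`. -/
noncomputable def normalizedIncrementCov (H h s t : ℝ) : ℝ :=
  (|(s - t) / h + 1| ^ (2 * H) + |(s - t) / h - 1| ^ (2 * H) - 2 * |(s - t) / h| ^ (2 * H)) / 2 -
  (|(s + t) / h + 1 + 1| ^ (2 * H) + |(s + t) / h + 1 - 1| ^ (2 * H)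
    - 2 * |(s + t) / h + 1| ^ (2 * H)) / 2

lemma abs_normalizedIncrementCov_le_const {H : ℝ} (h0 : 0 ≤ H) (h1 : H ≤ 1) (h s t : ℝ) :
    |normalizedIncrementCov H h s t| ≤ 18 := by
  have a1 := abs_second_difference_rpow_le_const (α := 2 * H) (by linarith) (by linarith)
    ((s - t) / h)
  have a2 := abs_second_difference_rpow_le_const (α := 2 * H) (by linarith) (by linarith)
    ((s + t) / h + 1)
  rw [abs_le] at a1 a2 ⊢
  unfold normalizedIncrementCov
  constructor <;> linarith [a1.1, a1.2, a2.1, a2.2]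

/-- As $s,t\ge0$ give $s+t\ge|s-t|$, the non-stationary part obeys the same decay bound as the
stationary one. -/
lemma abs_normalizedIncrementCov_le {H : ℝ} (h0 : 0 ≤ H) (h1 : H ≤ 1) {h s t N : ℝ} (hh : 0 < h)
    (hs : 0 ≤ s) (ht : 0 ≤ t) (hN : 1 < N) (hst : N * h ≤ |s - t|) :
    |normalizedIncrementCov H h s t| ≤ 2 * (N - 1) ^ (2 * H - 2) := by
  have a1 := abs_second_difference_rpow_le (α := 2 * H) (by linarith) (by linarith) hN
    (u := (s - t) / h) (by rw [abs_div, abs_of_pos hh, le_div_iff₀ hh]; exact hst)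
  have a2 := abs_second_difference_rpow_le (α := 2 * H) (by linarith) (by linarith) hN
    (u := (s + t) / h + 1) (by
      have : N ≤ (s + t) / h := by
        rw [le_div_iff₀ hh]
        refine hst.trans ?_
        rw [abs_le]; constructor <;> linarith
      exact (by linarith : N ≤ (s + t) / h + 1).trans (le_abs_self _))
  rw [abs_le] at a1 a2 ⊢
  unfold normalizedIncrementCov
  constructor <;> linarith [a1.1, a1.2, a2.1, a2.2]

lemma abs_div_rpow_eq {h x : ℝ} (hh : 0 < h) (H : ℝ) :
    |x / h| ^ (2 * H) = |x| ^ (2 * H) / (h ^ H * h ^ H) := by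
  rw [abs_div, abs_of_pos hh, Real.div_rpow (abs_nonneg _) hh.le, two_mul, ← Real.rpow_add hh]

/-- The one-variable terms $s^{2H}$, $t^{2H}$ cancel in the double increment. What remains is a
second difference centred at $s-t$ and one centred at $s+t+h$, whence the extra $1$ after division
by $h$. -/
lemma covariance_normalizedIncrement [IsProbabilityMeasure P] {H : ℝ} {S : ℝ≥0 → Ω → ℝ}
    (hS : IsSubfractionalBrownianMotion H S P) {h s t : ℝ} (hh : 0 < h) (hs : 0 ≤ s) (ht : 0 ≤ t) :
    cov[fun ω => (S (s + h).toNNReal ω - S s.toNNReal ω) / h ^ H,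
      fun ω => (S (t + h).toNNReal ω - S t.toNNReal ω) / h ^ H; P] =
      normalizedIncrementCov H h s t := by
  have hL (t : ℝ≥0) : MemLp (S t) 2 P := (hS.isGaussianProcess.hasGaussianLaw_eval t).memLp_two
  rw [covariance_fun_div_left, covariance_fun_div_right,
    covariance_fun_sub_left (Z := fun ω => S (t + h).toNNReal ω - S t.toNNReal ω)
      (hL _) (hL _) ((hL _).sub (hL _)),
    covariance_fun_sub_right (hL _) (hL _) (hL _), covariance_fun_sub_right (hL _) (hL _) (hL _)]
  simp only [hS.covariance_eq, Real.coe_toNNReal _ hs, Real.coe_toNNReal _ ht,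
    Real.coe_toNNReal _ (add_nonneg hs hh.le), Real.coe_toNNReal _ (add_nonneg ht hh.le)]
  have e1 : (s - t) / h + 1 = (s + h - t) / h := by field_simp; ring
  have e2 : (s - t) / h - 1 = (s - (t + h)) / h := by field_simp; ring
  have e3 : (s + t) / h + 1 + 1 = (s + h + (t + h)) / h := by field_simp; ring
  have e4 : (s + t) / h + 1 - 1 = (s + t) / h := by ring
  have e5 : (s + t) / h + 1 = (s + h + t) / h := by field_simp; ring
  have e6 : s + (t + h) = s + h + t := by ring
  have e7 : s + h - (t + h) = s - t := by ring
  unfold normalizedIncrementCov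
  rw [e3, e4, e5, e1, e2]
  simp only [abs_div_rpow_eq hh, e6, e7]
  rw [abs_of_nonneg (by positivity : 0 ≤ s + h + (t + h)), abs_of_nonneg (by positivity : 0 ≤ s + t),
    abs_of_nonneg (by positivity : 0 ≤ s + h + t)]
  have : 0 < h ^ H := by positivity
  field_simp
  ring

lemma isGaussianProcess_normalizedIncrement {S : ℝ≥0 → Ω → ℝ} (hS : IsGaussianProcess S P)
    (H h : ℝ) :
    IsGaussianProcess
      (fun (s : ℝ) ω => (S (s + h).toNNReal ω - S s.toNNReal ω) / h ^ H) P := by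
  classical
  refine hS.of_isGaussianProcess fun s => ⟨{(s + h).toNNReal, s.toNNReal},
    (h ^ H)⁻¹ • (ContinuousLinearMap.proj ⟨(s + h).toNNReal, by simp⟩ -
      ContinuousLinearMap.proj ⟨s.toNNReal, by simp⟩), fun ω => ?_⟩
  simp [Finset.restrict, div_eq_inv_mul]

lemma lintegral_exp_linear_combination {T : Type*} {Y : T → Ω → ℝ} (hY : IsGaussianProcess Y P)
    (h0 : ∀ t, ∫ ω, Y t ω ∂P = 0) (s t : T) (z w : ℝ) :
    ∫⁻ ω, ENNReal.ofReal (Real.exp (z * Y s ω + w * Y t ω)) ∂P =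
      ENNReal.ofReal (Real.exp ((cov[Y s, Y s; P] * z ^ 2 + 2 * cov[Y s, Y t; P] * z * w +
        cov[Y t, Y t; P] * w ^ 2) / 2)) := by
  have := hY.isProbabilityMeasure
  have hL (t : T) : MemLp (Y t) 2 P := (hY.hasGaussianLaw_eval t).memLp_two
  have hi (t : T) : Integrable (Y t) P := (hY.hasGaussianLaw_eval t).integrable
  have hg : HasGaussianLaw (fun ω => z * Y s ω + w * Y t ω) P :=
    (hY.hasGaussianLaw_prodMk (s := s) (t := t)).map_fun
      (z • ContinuousLinearMap.fst ℝ ℝ ℝ + w • ContinuousLinearMap.snd ℝ ℝ ℝ)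
  rw [lintegral_exp_of_hasGaussianLaw hg]
  · congr 3
    rw [← covariance_self hg.aemeasurable]
    change cov[z • Y s + w • Y t, z • Y s + w • Y t; P] = _
    rw [covariance_add_left ((hL s).const_smul z) ((hL t).const_smul w)
        (((hL s).const_smul z).add ((hL t).const_smul w)),
      covariance_add_right ((hL s).const_smul z) ((hL s).const_smul z) ((hL t).const_smul w),
      covariance_add_right ((hL t).const_smul w) ((hL s).const_smul z) ((hL t).const_smul w)]
    simp only [covariance_smul_left, covariance_smul_right]
    rw [covariance_comm (Y t) (Y s)]
    ring
  · rw [integral_add ((hi s).const_mul z) ((hi t).const_mul w), integral_const_mul,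
      integral_const_mul, h0, h0]
    simp

/-- Within distance $Nh$ of the diagonal the integrand is at most $1$ on a set of measure at most
$2Nh$; elsewhere the decay bound applies. -/
lemma lintegral_abs_normalizedIncrementCov_le {H : ℝ} (h0 : 0 ≤ H) (h1 : H ≤ 1) {h s N : ℝ}
    (hh : 0 < h) (hs : 0 ≤ s) (hN : 1 < N) {A : Set ℝ} (hA : MeasurableSet A) (hA1 : A ⊆ Ioo 0 1) :
    ∫⁻ t in A, ENNReal.ofReal (|normalizedIncrementCov H h s t| / 18) ≤
      ENNReal.ofReal (2 * (N * h) + (N - 1) ^ (2 * H - 2)) := by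
  set J := Icc (s - N * h) (s + N * h) with hJ
  calc ∫⁻ t in A, ENNReal.ofReal (|normalizedIncrementCov H h s t| / 18)
      ≤ ∫⁻ t in A, (J.indicator 1 t + ENNReal.ofReal ((N - 1) ^ (2 * H - 2))) := by
        refine setLIntegral_mono' hA fun t ht => ?_
        by_cases htJ : t ∈ J
        · rw [indicator_of_mem htJ]
          refine le_trans ?_ le_self_add
          simp only [Pi.one_apply, ENNReal.ofReal_le_one]
          linarith [abs_normalizedIncrementCov_le_const h0 h1 h s t]
        · refine le_trans (ENNReal.ofReal_le_ofReal ?_) le_add_self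
          have : N * h ≤ |s - t| := by
            by_contra! hlt
            rw [abs_lt] at hlt
            exact htJ ⟨by linarith [hlt.2], by linarith [hlt.1]⟩
          have h2 := abs_normalizedIncrementCov_le h0 h1 hh hs (hA1 ht).1.le hN this
          have : 0 ≤ (N - 1) ^ (2 * H - 2) := Real.rpow_nonneg (by linarith) _
          linarith
    _ = (∫⁻ t in A, J.indicator 1 t) + ENNReal.ofReal ((N - 1) ^ (2 * H - 2)) * volume A := by
        rw [lintegral_add_right _ measurable_const, setLIntegral_const]
    _ ≤ volume J + ENNReal.ofReal ((N - 1) ^ (2 * H - 2)) * 1 := by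
        gcongr
        · refine (setLIntegral_le_lintegral _ _).trans ?_
          rw [lintegral_indicator_one measurableSet_Icc]
        · refine (measure_mono hA1).trans ?_
          simp
    _ = _ := by
        rw [hJ, Real.volume_Icc, mul_one, ← ENNReal.ofReal_add]
        · ring_nf
        · nlinarith
        · exact Real.rpow_nonneg (by linarith) _

lemma volume_shiftDomain_le_one (h : ℝ) : volume (shiftDomain h) ≤ 1 := by
  refine (measure_mono (fun s hs => hs.1)).trans (?_ : volume (Ioo (0 : ℝ) 1) ≤ 1)
  simp

/-! ### Exponential integrals of the sub-fractional increments. -/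

section Increments

variable {H : ℝ} {S : ℝ≥0 → Ω → ℝ} {F : ℝ × Ω → ℝ} {c d : ℝ}

lemma ae_shiftDomain_modification (hF : ∀ᵐ s ∂(volume.restrict (Ioo (0 : ℝ) 1)), ∀ᵐ ω ∂P,
      S s.toNNReal ω = F (s, ω)) (d : ℝ) :
    ∀ᵐ s ∂(volume.restrict (shiftDomain d)), s ∈ shiftDomain d ∧
      (∀ᵐ ω ∂P, S s.toNNReal ω = F (s, ω)) ∧ ∀ᵐ ω ∂P, S (s + d).toNNReal ω = F (s + d, ω) := by
  rw [ae_restrict_iff' measurableSet_Ioo] at hF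
  have h2 := (measurePreserving_add_right (volume : Measure ℝ) d).quasiMeasurePreserving.ae hF
  rw [ae_restrict_iff' (measurableSet_shiftDomain d)]
  filter_upwards [hF, h2] with s h3 h4 hs
  exact ⟨hs, h3 hs.1, h4 hs.2⟩

variable [IsProbabilityMeasure P]

lemma lintegral_exp_increment_combination (hS : IsSubfractionalBrownianMotion H S P) (hd : 0 < d)
    {s t : ℝ} (hs : s ∈ shiftDomain d) (ht : t ∈ shiftDomain d)
    (hFs : ∀ᵐ ω ∂P, S s.toNNReal ω = F (s, ω)) (hFs' : ∀ᵐ ω ∂P, S (s + d).toNNReal ω = F (s + d, ω))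
    (hFt : ∀ᵐ ω ∂P, S t.toNNReal ω = F (t, ω)) (hFt' : ∀ᵐ ω ∂P, S (t + d).toNNReal ω = F (t + d, ω))
    (z w : ℝ) :
    ∫⁻ ω, ENNReal.ofReal (Real.exp (z * ((F (s + d, ω) - F (s, ω)) / d ^ H) +
        w * ((F (t + d, ω) - F (t, ω)) / d ^ H))) ∂P =
      ENNReal.ofReal (Real.exp ((normalizedIncrementCov H d s s * z ^ 2 +
        2 * normalizedIncrementCov H d s t * z * w + normalizedIncrementCov H d t t * w ^ 2) / 2)) := by
  have hi (u : ℝ≥0) : Integrable (S u) P := (hS.isGaussianProcess.hasGaussianLaw_eval u).integrable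
  have h := lintegral_exp_linear_combination
    (isGaussianProcess_normalizedIncrement hS.isGaussianProcess H d)
    (fun t => by rw [integral_div, integral_sub (hi _) (hi _), hS.centred, hS.centred]; simp) s t z w
  have hs0 := hs.1.1.le
  have ht0 := ht.1.1.le
  rw [covariance_normalizedIncrement hS hd hs0 hs0, covariance_normalizedIncrement hS hd hs0 ht0,
    covariance_normalizedIncrement hS hd ht0 ht0] at h
  rw [← h]
  refine lintegral_congr_ae ?_
  filter_upwards [hFs, hFs', hFt, hFt'] with ω h1 h2 h3 h4
  rw [h1, h2, h3, h4]

lemma lintegral_lintegral_exp_increment_sq_le (hH0 : 0 < H) (hH1 : H < 1)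
    (hS : IsSubfractionalBrownianMotion H S P) (hFm : Measurable F)
    (hF : ∀ᵐ s ∂(volume.restrict (Ioo (0 : ℝ) 1)), ∀ᵐ ω ∂P, S s.toNNReal ω = F (s, ω))
    (hc : 0 ≤ c) (hd : 0 < d) :
    ∫⁻ ω, (∫⁻ s in shiftDomain d,
        ENNReal.ofReal (Real.exp (c * ((F (s + d, ω) - F (s, ω)) / d ^ H) ^ 2))) ∂P ≤
      ∫⁻ z, ENNReal.ofReal (Real.exp (2 * c * 18 * z ^ 2)) ∂(gaussianReal 0 1) := by
  rw [lintegral_lintegral_swap (by fun_prop)]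
  calc _ ≤ ∫⁻ _ in shiftDomain d,
        (∫⁻ z, ENNReal.ofReal (Real.exp (2 * c * 18 * z ^ 2)) ∂(gaussianReal 0 1)) := by
        refine lintegral_mono_ae ?_
        filter_upwards [ae_shiftDomain_modification hF d] with s hs
        refine lintegral_exp_sq_le (a := normalizedIncrementCov H d s s) (by fun_prop) hc ?_ fun z => ?_
        · linarith [(abs_le.1 (abs_normalizedIncrementCov_le_const hH0.le hH1.le d s s)).2]
        · simpa using lintegral_exp_increment_combination hS hd hs.1 hs.1 hs.2.1 hs.2.2 hs.2.1 hs.2.2 z 0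
    _ ≤ _ := by
        rw [setLIntegral_const]
        exact mul_le_of_le_one_right' (volume_shiftDomain_le_one d)

lemma lintegral_tsub_sq_exp_increment_le (hH0 : 0 < H) (hH1 : H < 1)
    (hS : IsSubfractionalBrownianMotion H S P) (hFm : Measurable F)
    (hF : ∀ᵐ s ∂(volume.restrict (Ioo (0 : ℝ) 1)), ∀ᵐ ω ∂P, S s.toNNReal ω = F (s, ω))
    (hc : 0 ≤ c) (hd : 0 < d) {N : ℝ} (hN : 1 < N)
    (hκ : ∫⁻ z, ENNReal.ofReal (Real.exp (2 * c * 18 * z ^ 2)) ∂(gaussianReal 0 1) ≠ ∞) :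
    ∫⁻ ω, ((∫⁻ s in shiftDomain d,
        ENNReal.ofReal (Real.exp (c * ((F (s + d, ω) - F (s, ω)) / d ^ H) ^ 2))) -
        ∫⁻ ω, (∫⁻ s in shiftDomain d,
        ENNReal.ofReal (Real.exp (c * ((F (s + d, ω) - F (s, ω)) / d ^ H) ^ 2))) ∂P) ^ 2 ∂P ≤
      ENNReal.ofReal (2 * (N * d) + (N - 1) ^ (2 * H - 2)) *
        (∫⁻ z, ENNReal.ofReal (Real.exp (2 * c * 18 * z ^ 2)) ∂(gaussianReal 0 1)) ^ 2 := by
  set κ := ∫⁻ z, ENNReal.ofReal (Real.exp (2 * c * 18 * z ^ 2)) ∂(gaussianReal 0 1) with hκ'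
  have hmod := ae_shiftDomain_modification hF d
  refine (lintegral_tsub_sq_le (μ := volume.restrict (shiftDomain d))
    (φ := fun s ω => ENNReal.ofReal (Real.exp (c * ((F (s + d, ω) - F (s, ω)) / d ^ H) ^ 2)))
    (ρ := fun s t => ENNReal.ofReal (|normalizedIncrementCov H d s t| / 18) * κ ^ 2)
    (by fun_prop) ?_ (ne_top_of_le_ne_top hκ
      (lintegral_lintegral_exp_increment_sq_le hH0 hH1 hS hFm hF hc hd))).trans ?_
  · have hle := abs_normalizedIncrementCov_le_const hH0.le hH1.le d
    filter_upwards [hmod] with s hs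
    filter_upwards [hmod] with t ht
    exact lintegral_exp_sq_mul_exp_sq_le (by fun_prop) (by fun_prop) (by norm_num) hc
      (abs_le.1 (hle s s)).2 (abs_le.1 (hle t t)).2 (hle s t)
      (lintegral_exp_increment_combination hS hd hs.1 ht.1 hs.2.1 hs.2.2 ht.2.1 ht.2.2)
  · calc _ ≤ ∫⁻ _ in shiftDomain d, ENNReal.ofReal (2 * (N * d) + (N - 1) ^ (2 * H - 2)) * κ ^ 2 := by
          refine setLIntegral_mono' (measurableSet_shiftDomain d) fun s hs => ?_
          rw [lintegral_mul_const' _ _ (by finiteness)]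
          gcongr
          exact lintegral_abs_normalizedIncrementCov_le hH0.le hH1.le hd hs.1.1.le hN
            (measurableSet_shiftDomain d) fun t ht => ht.1
      _ ≤ _ := by
          rw [setLIntegral_const]
          exact mul_le_of_le_one_right' (volume_shiftDomain_le_one d)

lemma ae_exists_bound_lintegral_exp_increment_sq (hH0 : 0 < H) (hH1 : H < 1)
    (hS : IsSubfractionalBrownianMotion H S P) (hFm : Measurable F)
    (hF : ∀ᵐ s ∂(volume.restrict (Ioo (0 : ℝ) 1)), ∀ᵐ ω ∂P, S s.toNNReal ω = F (s, ω))
    (hc : 0 ≤ c)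
    (hκ : ∫⁻ z, ENNReal.ofReal (Real.exp (2 * c * 18 * z ^ 2)) ∂(gaussianReal 0 1) ≠ ∞) :
    ∀ᵐ ω ∂P, ∃ M : ℝ, 1 ≤ M ∧ ∀ n : ℕ, ∫⁻ s in shiftDomain ((1 / 2) ^ (n + 1)),
      ENNReal.ofReal (Real.exp
        (c * ((F (s + (1 / 2) ^ (n + 1), ω) - F (s, ω)) / ((1 / 2) ^ (n + 1)) ^ H) ^ 2)) ≤
        ENNReal.ofReal M := by
  -- With $N=1+2^{(n+1)/2}$ and $d=2^{-(n+1)}$, both $Nd$ and $(N-1)^{2H-2}$ decay geometrically,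
  -- the latter because $H<1$.
  refine ae_exists_bound_of_tsum_lintegral_tsub_sq (fun n => ?_) hκ (fun n =>
    lintegral_lintegral_exp_increment_sq_le hH0 hH1 hS hFm hF hc
      (by positivity : (0 : ℝ) < (1 / 2) ^ (n + 1))) (ne_top_of_le_ne_top ?_
    (ENNReal.tsum_le_tsum fun n => lintegral_tsub_sq_exp_increment_le hH0 hH1 hS hFm hF hc
      (by positivity : (0 : ℝ) < (1 / 2) ^ (n + 1)) (N := 1 + √2 ^ (n + 1))
      (lt_add_of_pos_right _ (by positivity)) hκ))
  · exact Measurable.lintegral_prod_left' (f := fun x : ℝ × Ω => ENNReal.ofReal (Real.exp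
      (c * ((F (x.1 + (1 / 2) ^ (n + 1), x.2) - F (x.1, x.2)) / ((1 / 2) ^ (n + 1)) ^ H) ^ 2)))
      (by fun_prop)
  · rw [ENNReal.tsum_mul_right]
    refine ENNReal.mul_ne_top (Summable.tsum_ofReal_ne_top ?_) (by finiteness)
    have h2 : (1 : ℝ) < √2 := by rw [Real.lt_sqrt] <;> norm_num
    have e (n : ℕ) : 2 * ((1 + √2 ^ (n + 1)) * (1 / 2 : ℝ) ^ (n + 1)) +
        (1 + √2 ^ (n + 1) - 1) ^ (2 * H - 2) =
        (1 / 2) ^ n + √2 * (√2 / 2) ^ n + √2 ^ (2 * H - 2) * (√2 ^ (2 * H - 2)) ^ n := by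
      rw [add_sub_cancel_left, ← Real.rpow_natCast (√2) (n + 1), ← Real.rpow_mul (by positivity),
        mul_comm ((n + 1 : ℕ) : ℝ), Real.rpow_mul (by positivity), Real.rpow_natCast,
        Real.rpow_natCast, pow_succ' (√2 ^ (2 * H - 2)), div_pow, div_pow, div_pow, one_pow, one_pow, pow_succ,
        pow_succ]
      field_simp
    simp_rw [e]
    refine ((summable_geometric_of_lt_one (by norm_num) (by norm_num)).add
      ((summable_geometric_of_lt_one (by positivity) ?_).mul_left _)).add
      ((summable_geometric_of_lt_one (by positivity) ?_).mul_left _)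
    · rw [div_lt_one (by norm_num), Real.sqrt_lt' (by norm_num)]; norm_num
    · exact Real.rpow_lt_one_of_one_lt_of_neg h2 (by linarith)

lemma ae_lintegral_exp_sq_lt_top (hH0 : 0 < H)
    (hS : IsSubfractionalBrownianMotion H S P) (hFm : Measurable F)
    (hF : ∀ᵐ s ∂(volume.restrict (Ioo (0 : ℝ) 1)), ∀ᵐ ω ∂P, S s.toNNReal ω = F (s, ω))
    (hc : 0 ≤ c)
    (hκ : ∫⁻ z, ENNReal.ofReal (Real.exp (2 * c * 18 * z ^ 2)) ∂(gaussianReal 0 1) ≠ ∞) :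
    ∀ᵐ ω ∂P, ∫⁻ s in Ioo (0 : ℝ) 1, ENNReal.ofReal (Real.exp (c * F (s, ω) ^ 2)) < ∞ := by
  refine ae_lt_top (Measurable.lintegral_prod_left' (f := fun x : ℝ × Ω => ENNReal.ofReal (Real.exp
      (c * F (x.1, x.2) ^ 2))) (by fun_prop)) (ne_top_of_le_ne_top hκ ?_)
  rw [lintegral_lintegral_swap (by fun_prop)]
  calc _ ≤ ∫⁻ _ in Ioo (0 : ℝ) 1,
        (∫⁻ z, ENNReal.ofReal (Real.exp (2 * c * 18 * z ^ 2)) ∂(gaussianReal 0 1)) := by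
        refine lintegral_mono_ae ?_
        filter_upwards [hF, ae_restrict_mem measurableSet_Ioo] with s hs hs1
        refine lintegral_exp_sq_le (a := cov[S s.toNNReal, S s.toNNReal; P]) (by fun_prop) hc ?_
          fun z => ?_
        · rw [hS.covariance_eq, Real.coe_toNNReal _ hs1.1.le]
          have h1 : s ^ (2 * H) ≤ 1 := Real.rpow_le_one hs1.1.le hs1.2.le (by linarith)
          have h2 : 0 ≤ (s + s) ^ (2 * H) := Real.rpow_nonneg (by linarith [hs1.1]) _
          have h3 : 0 ≤ |s - s| ^ (2 * H) := by positivity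
          linarith
        · have h := lintegral_exp_linear_combination hS.isGaussianProcess hS.centred
            s.toNNReal s.toNNReal z 0
          simp only [zero_mul, add_zero, mul_zero, ne_eq, OfNat.ofNat_ne_zero, not_false_eq_true,
            zero_pow] at h
          rw [← h]
          refine lintegral_congr_ae ?_
          filter_upwards [hs] with ω hω
          rw [hω]
    _ ≤ _ := by
        rw [setLIntegral_const]
        simp

end Increments

end GaussianProcesses

theorem mainTheorem3 {Ω : Type*} [MeasurableSpace Ω] (P : Measure Ω) [IsProbabilityMeasure P]
    (H : ℝ) (hH0 : 0 < H) (hH1 : H < 1) (S : ℝ≥0 → Ω → ℝ)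
    (hS : IsSubfractionalBrownianMotion H S P)
    (hmeas : AEMeasurable (fun x : ℝ × Ω => S x.1.toNNReal x.2)
      ((volume.restrict (Ioo (0 : ℝ) 1)).prod P)) :
    ∀ᵐ ω ∂P, (fun t : ℝ => S t.toNNReal ω) ∈ BesovOrliczSpace H 2 := by
  obtain ⟨F, hFm, hSF⟩ := hmeas
  -- Fubini in both orders: one statement transfers the Gaussian laws to $F(s,\cdot)$ for almost
  -- every $s$, the other identifies almost every path with $F(\cdot,\omega)$ almost everywhere.
  have hF : ∀ᵐ s ∂(volume.restrict (Ioo (0 : ℝ) 1)), ∀ᵐ ω ∂P, S s.toNNReal ω = F (s, ω) :=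
    Measure.ae_ae_of_ae_prod hSF
  have hF' : ∀ᵐ ω ∂P, ∀ᵐ s ∂(volume.restrict (Ioo (0 : ℝ) 1)), S s.toNNReal ω = F (s, ω) :=
    Measure.ae_ae_of_ae_prod (Measure.measurePreserving_swap.quasiMeasurePreserving.ae hSF)
  obtain ⟨C, hC, hCfin⟩ := exists_lintegral_exp_sq_gaussianReal_lt_top
  -- Chosen so that $2\cdot18\cdot c=C$, the exponent supplied by Fernique's theorem for the
  -- standard Gaussian.
  have hc : 0 < C / 36 := by positivity
  have hκ : ∫⁻ z, ENNReal.ofReal (Real.exp (2 * (C / 36) * 18 * z ^ 2)) ∂(gaussianReal 0 1) ≠ ∞ := by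
    rw [show 2 * (C / 36) * 18 = C by ring]
    exact hCfin.ne
  filter_upwards [hF', ae_exists_bound_lintegral_exp_increment_sq hH0 hH1 hS hFm hF hc.le hκ,
    ae_lintegral_exp_sq_lt_top hH0 hS hFm hF hc.le hκ] with ω h1 ⟨M, hM, h2⟩ h3
  refine mem_besovOrliczSpace_congr h1 ?_
  set I := ∫⁻ s in Ioo (0 : ℝ) 1, ENNReal.ofReal (Real.exp (C / 36 * F (s, ω) ^ 2)) with hI
  refine mem_besovOrliczSpace_of_lintegral_exp_sq (by fun_prop) hH0 hc (M := max M I.toReal)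
    (hM.trans (le_max_left _ _)) ?_ fun n => (h2 n).trans (ENNReal.ofReal_le_ofReal (le_max_left _ _))
  rw [← hI]
  exact (ENNReal.ofReal_toReal h3.ne).ge.trans <| ENNReal.ofReal_le_ofReal (le_max_right _ _)
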